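/- **Setting.** A \emph{probabilistic theory} is a set $\mathcal K$ (of \emph{states}) in a real Banach space that is $\sigma$-convex: if $\lambda_i\ge 0$, $\sum_{i=1}^\infty\lambda_i=1$ and $v_i\in\mathcal K$, then $\sum\lambda_i v_i$ converges in norm to an element of $\mathcal K$. An $n$-dimensional observable is a $\sigma$-affine map from $\mathcal K$ to the Borel probability measures on $\mathbb R^n$; $\mathcal O(\mathcal K)$ is the set of $1$-dimensional observables, and $T\in\mathcal O(\mathcal K)$ is \emph{trivial} if $T(s)=p$ for all $s\in\mathcal K$, for a fixed probability measure $p$ on $\mathbb R$. Observables $M,N\in\mathcal O(\mathcal K)$ are \emph{compatible} if there is a $2$-dimensional observable whose marginals are $M$ and $N$, and incompatible otherwise. Let $I(M,N)$ be the set of $\lambda\in[0,1]$ such that $M$ is compatible with $\lambda N+(1-\lambda)T$ for some trivial $T$, and put $\lambda(M,N)=\sup I(M,N)$, $I(\mathcal K)=\bigcap_{M,N\in\mathcal O(\mathcal K)} I(M,N)$ and $\lambda(\mathcal K)=\inf_{M,N\in\mathcal O(\mathcal K)}\lambda(M,N)$. **Statement.** Let $H$ be a complex Hilbert space with $\dim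 H\ge 2$, and let $\mathcal K$ be the $\sigma$-convex set of positive trace-one operators on $H$, in the real Banach space of self-adjoint trace-class operators with the trace norm. Let $H_0\subseteq H$ be any $2$-dimensional subspace with an orthonormal basis, let $\sigma_x,\sigma_y$ be the operators on $H$ that are given on $H_0$ by the Pauli matrices in this basis and that vanish on $H_0^\perp$, and let $M_x,M_y\in\mathcal O(\mathcal K)$ be the observables $s\mapsto(A\mapsto\mathrm{tr}[sP(A)])$ of the POVMs $P$ on $\mathbb R$ concentrated on $\{1,-1\}$ with $P(\{\pm1\})=\tfrac12(I\pm\sigma_x)$ and $P(\{\pm1\})=\tfrac12(I\pm\sigma_y)$, respectively. Then: 1. for every $\mu\in[0,1]$ and every trivial $T$, $M_x$ is compatible with $\mu M_y+(1-\mu)T$ if and only if $\mu=0$; in particular they are incompatible for every $\mu\in(0,1]$; 2. $I(M_x,M_y)=\{0\}$ and $\lambda(M_x,M_y)=0$; 3. $I(\mathcal K)=\{0\}$ and $\lambda(\mathcal K)=0$; 4. this index is the smallest possible: $\lambda(\mathcal K)\le\lambda(\mathcal K')$ for every probabilistic theory $\mathcal K'$. -/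

import Mathlib

open scoped NNReal ENNReal InnerProductSpace
open MeasureTheory

noncomputable section

namespace GPT

section Hilbert
variable {H : Type*} [NormedAddCommGroup H] [InnerProductSpace ℂ H] [CompleteSpace H]

/-- The index set of a fixed orthonormal (Hilbert) basis of `H`. -/
def basisIndex (H : Type*) [NormedAddCommGroup H] [InnerProductSpace ℂ H] [CompleteSpace H] :
    Set H :=
  (exists_hilbertBasis ℂ H).choose

/-- A fixed orthonormal (Hilbert) basis of `H`. -/
def basis (H : Type*) [NormedAddCommGroup H] [InnerProductSpace ℂ H] [CompleteSpace H] :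
    HilbertBasis (basisIndex H) ℂ H :=
  (exists_hilbertBasis ℂ H).choose_spec.choose

/-- The trace `∑ ⟨b i, A (b i)⟩` of an operator (meaningful for trace-class `A`). -/
def opTrace (A : H →L[ℂ] H) : ℂ :=
  ∑' i, ⟪basis H i, A (basis H i)⟫_ℂ

/-- The trace of a positive operator, as an element of `[0, ∞]`. -/
def posTrace (A : H →L[ℂ] H) : ℝ≥0∞ :=
  ∑' i, ‖⟪basis H i, A (basis H i)⟫_ℂ‖ₑ

/-- The trace norm `tr |A|`, where `|A| = √(A⋆A)`. -/
def traceNorm (A : H →L[ℂ] H) : ℝ≥0∞ :=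
  posTrace (CFC.abs A)

lemma parseval {ι : Type*} (b : HilbertBasis ι ℂ H) (x : H) :
    ∑' i, ‖⟪b i, x⟫_ℂ‖ₑ ^ 2 = ‖x‖ₑ ^ 2 := by
  have h := b.hasSum_inner_mul_inner x x
  have h2 : HasSum (fun i => ‖⟪b i, x⟫_ℂ‖ ^ 2) (‖x‖ ^ 2) := by
    have h3 := Complex.hasSum_re h
    convert h3 using 1
    · ext i
      rw [← inner_conj_symm x (b i), RCLike.conj_mul]
      norm_cast
    · rw [inner_self_eq_norm_sq_to_K]
      norm_cast
  have h4 := ENNReal.ofReal_tsum_of_nonneg (fun i => sq_nonneg _) h2.summable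
  rw [h2.tsum_eq] at h4
  simp only [ENNReal.ofReal_pow (norm_nonneg _), ofReal_norm] at h4
  exact h4.symm

lemma hs_adjoint {ι κ : Type*} (b : HilbertBasis ι ℂ H) (c : HilbertBasis κ ℂ H)
    (T : H →L[ℂ] H) :
    ∑' i, ‖T (b i)‖ₑ ^ 2 = ∑' j, ‖(ContinuousLinearMap.adjoint T) (c j)‖ₑ ^ 2 := by
  simp_rw [← parseval c (T _), ← parseval b ((ContinuousLinearMap.adjoint T) _)]
  rw [ENNReal.tsum_comm]
  congr! 5 with j i
  rw [ContinuousLinearMap.adjoint_inner_right, ← inner_conj_symm, enorm_eq_nnnorm, enorm_eq_nnnorm,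
    RCLike.nnnorm_conj]

lemma sqrt_adjoint (A : H →L[ℂ] H) :
    ContinuousLinearMap.adjoint (CFC.sqrt A) = CFC.sqrt A :=
  (IsSelfAdjoint.of_nonneg (CFC.sqrt_nonneg A)).adjoint_eq

lemma inner_sqrt {A : H →L[ℂ] H} (hA : 0 ≤ A) (x y : H) :
    ⟪x, A y⟫_ℂ = ⟪CFC.sqrt A x, CFC.sqrt A y⟫_ℂ := by
  conv_lhs => rw [← CFC.sqrt_mul_sqrt_self A hA]
  rw [mul_apply_eq_comp, ← ContinuousLinearMap.adjoint_inner_left, sqrt_adjoint]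

lemma enorm_inner_sqrt {A : H →L[ℂ] H} (hA : 0 ≤ A) (x : H) :
    ‖⟪x, A x⟫_ℂ‖ₑ = ‖CFC.sqrt A x‖ₑ ^ 2 := by
  rw [inner_sqrt hA, inner_self_eq_norm_sq_to_K, enorm_pow]
  congr 1
  simp [enorm_eq_nnnorm]

lemma inner_eq_ofReal {A : H →L[ℂ] H} (hA : 0 ≤ A) (x : H) :
    ⟪x, A x⟫_ℂ = ((‖⟪x, A x⟫_ℂ‖ : ℝ) : ℂ) := by
  rw [inner_sqrt hA, inner_self_eq_norm_sq_to_K]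
  simp

lemma posTrace_eq_basis {ι : Type*} (b : HilbertBasis ι ℂ H) {A : H →L[ℂ] H} (hA : 0 ≤ A) :
    posTrace A = ∑' i, ‖⟪b i, A (b i)⟫_ℂ‖ₑ := by
  unfold posTrace
  simp_rw [enorm_inner_sqrt hA]
  rw [hs_adjoint (basis H) b, sqrt_adjoint]

lemma sum_le_posTrace {ι : Type*} [Fintype ι] {e : ι → H} (he : Orthonormal ℂ e)
    {A : H →L[ℂ] H} (hA : 0 ≤ A) :
    ∑ i, ‖⟪e i, A (e i)⟫_ℂ‖ₑ ≤ posTrace A := by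
  obtain ⟨w, b, hw, hb⟩ := he.toSubtypeRange.exists_hilbertBasis_extension
  rw [posTrace_eq_basis b hA, ← tsum_fintype (L := .unconditional _)]
  have hinj : Function.Injective (fun i : ι => (⟨e i, hw ⟨i, rfl⟩⟩ : w)) := by
    intro i j hij
    exact he.linearIndependent.injective (by simpa using hij)
  refine le_trans (le_of_eq ?_) (ENNReal.tsum_comp_le_tsum_of_injective hinj _)
  simp [hb]

lemma two_mul_le (a b : ℝ≥0∞) : 2 * (a * b) ≤ a ^ 2 + b ^ 2 := by
  induction a with
  | top => simp
  | coe a =>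
    induction b with
    | top => simp
    | coe b =>
      rw [← mul_assoc]
      exact_mod_cast two_mul_le_add_sq a b

lemma sum_le_posTrace' {ι : Type*} [Fintype ι] {e f : ι → H} (he : Orthonormal ℂ e)
    (hf : Orthonormal ℂ f) {A : H →L[ℂ] H} (hA : 0 ≤ A) :
    ∑ i, ‖⟪f i, A (e i)⟫_ℂ‖ₑ ≤ posTrace A := by
  have h1 : 2 * ∑ i, ‖⟪f i, A (e i)⟫_ℂ‖ₑ ≤ 2 * posTrace A := by
    calc 2 * ∑ i, ‖⟪f i, A (e i)⟫_ℂ‖ₑ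
        ≤ ∑ i, (‖⟪f i, A (f i)⟫_ℂ‖ₑ + ‖⟪e i, A (e i)⟫_ℂ‖ₑ) := by
          rw [Finset.mul_sum]
          refine Finset.sum_le_sum fun i _ => ?_
          rw [enorm_inner_sqrt hA, enorm_inner_sqrt hA, inner_sqrt hA]
          refine le_trans ?_ (two_mul_le _ _)
          gcongr
          simp only [← ofReal_norm]
          rw [← ENNReal.ofReal_mul (norm_nonneg _)]
          exact ENNReal.ofReal_le_ofReal (norm_inner_le_norm _ _)
      _ ≤ posTrace A + posTrace A := by
          rw [Finset.sum_add_distrib]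
          exact add_le_add (sum_le_posTrace hf hA) (sum_le_posTrace he hA)
      _ = 2 * posTrace A := (two_mul _).symm
  exact (ENNReal.mul_le_mul_iff_right (by simp) (by simp)).1 h1

/-- The supremum of `∑ |⟨f k, A (e k)⟩|` over finite orthonormal families; an auxiliary
description of the trace norm. -/
def supNorm (A : H →L[ℂ] H) : ℝ≥0∞ :=
  ⨆ (n : ℕ) (e : Fin n → H) (f : Fin n → H) (_ : Orthonormal ℂ e) (_ : Orthonormal ℂ f),
    ∑ k, ‖⟪f k, A (e k)⟫_ℂ‖ₑ

lemma le_supNorm (A : H →L[ℂ] H) {n : ℕ} {e f : Fin n → H} (he : Orthonormal ℂ e)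
    (hf : Orthonormal ℂ f) : ∑ k, ‖⟪f k, A (e k)⟫_ℂ‖ₑ ≤ supNorm A :=
  le_iSup_of_le n <| le_iSup_of_le e <| le_iSup_of_le f <| le_iSup_of_le he <|
    le_iSup_of_le hf le_rfl

lemma supNorm_le {A : H →L[ℂ] H} {C : ℝ≥0∞}
    (h : ∀ (n : ℕ) (e f : Fin n → H), Orthonormal ℂ e → Orthonormal ℂ f →
      ∑ k, ‖⟪f k, A (e k)⟫_ℂ‖ₑ ≤ C) : supNorm A ≤ C :=
  iSup_le fun n => iSup_le fun e => iSup_le fun f => iSup_le fun he => iSup_le fun hf =>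
    h n e f he hf

lemma enorm_apply_le_supNorm (A : H →L[ℂ] H) (x : H) : ‖A x‖ₑ ≤ supNorm A * ‖x‖ₑ := by
  by_cases hx : x = 0
  · simp [hx]
  by_cases hy : A x = 0
  · simp [hy]
  have h := le_supNorm A (n := 1) (e := fun _ => ((‖x‖⁻¹ : ℝ) : ℂ) • x)
    (f := fun _ => ((‖A x‖⁻¹ : ℝ) : ℂ) • A x)
    ⟨fun i => by simp [norm_smul, hx], fun i j h => absurd (Subsingleton.elim i j) h⟩
    ⟨fun i => by simp [norm_smul, hy], fun i j h => absurd (Subsingleton.elim i j) h⟩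
  have h2 : ‖A x‖ₑ = ENNReal.ofReal (‖A x‖ * ‖x‖⁻¹) * ‖x‖ₑ := by
    rw [← ofReal_norm x, ← ENNReal.ofReal_mul (by positivity), ← ofReal_norm]
    congr 1
    have : ‖x‖ ≠ 0 := norm_ne_zero_iff.2 hx
    field_simp
  rw [h2]
  gcongr
  refine le_trans (le_of_eq ?_) h
  simp only [Fin.sum_univ_one, map_smul, inner_smul_left, inner_smul_right,
    inner_self_eq_norm_sq_to_K]
  rw [← ofReal_norm]
  congr 1
  have : ‖A x‖ ≠ 0 := norm_ne_zero_iff.2 hy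
  simp
  field_simp

lemma posTrace_add {A B : H →L[ℂ] H} (hA : 0 ≤ A) (hB : 0 ≤ B) :
    posTrace (A + B) = posTrace A + posTrace B := by
  unfold posTrace
  rw [← ENNReal.tsum_add]
  congr with i
  rw [add_apply, inner_add_right, inner_eq_ofReal hA, inner_eq_ofReal hB,
    ← Complex.ofReal_add, ← ofReal_norm, Complex.norm_of_nonneg (by positivity),
    ENNReal.ofReal_add (by positivity) (by positivity), ofReal_norm, ofReal_norm,
    ← inner_eq_ofReal hA, ← inner_eq_ofReal hB]

lemma traceNorm_eq {A : H →L[ℂ] H} (hA : IsSelfAdjoint A) :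
    traceNorm A = posTrace A⁺ + posTrace A⁻ := by
  unfold traceNorm
  rw [← CFC.posPart_add_negPart A hA,
    posTrace_add (CFC.posPart_nonneg A) (CFC.negPart_nonneg A)]

lemma supNorm_le_traceNorm {A : H →L[ℂ] H} (hA : IsSelfAdjoint A) :
    supNorm A ≤ traceNorm A := by
  rw [traceNorm_eq hA]
  refine supNorm_le fun n e f he hf => ?_
  calc ∑ k, ‖⟪f k, A (e k)⟫_ℂ‖ₑ
      ≤ ∑ k, (‖⟪f k, A⁺ (e k)⟫_ℂ‖ₑ + ‖⟪f k, A⁻ (e k)⟫_ℂ‖ₑ) := by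
        refine Finset.sum_le_sum fun k _ => ?_
        conv_lhs => rw [← CFC.posPart_sub_negPart A hA]
        rw [sub_apply, inner_sub_right]
        exact enorm_sub_le
    _ ≤ _ := by
        rw [Finset.sum_add_distrib]
        exact add_le_add (sum_le_posTrace' he hf (CFC.posPart_nonneg A))
          (sum_le_posTrace' he hf (CFC.negPart_nonneg A))

lemma sum_le_supNorm (A : H →L[ℂ] H) {ι : Type*} {b : ι → H} (hb : Orthonormal ℂ b) :
    ∑' i, ‖⟪b i, A (b i)⟫_ℂ‖ₑ ≤ supNorm A := by
  rw [ENNReal.tsum_eq_iSup_sum]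
  refine iSup_le fun s => ?_
  have h := le_supNorm A (n := s.card) (e := fun k => b (s.equivFin.symm k))
    (f := fun k => b (s.equivFin.symm k))
    (hb.comp _ (Subtype.val_injective.comp s.equivFin.symm.injective))
    (hb.comp _ (Subtype.val_injective.comp s.equivFin.symm.injective))
  refine le_trans (le_of_eq ?_) h
  rw [← Finset.sum_coe_sort s]
  exact (Equiv.sum_comp s.equivFin.symm (fun i : s => ‖⟪b i, A (b i)⟫_ℂ‖ₑ)).symm

/-- There is a Hilbert basis each of whose members is killed by the positive or the negative part
of `A`. -/
lemma exists_adapted_basis (A : H →L[ℂ] H) :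
    ∃ (w : Set H) (b : HilbertBasis w ℂ H), ∀ i, A⁺ (b i) = 0 ∨ A⁻ (b i) = 0 := by
  set P : H →L[ℂ] H := A⁺
  set N : H →L[ℂ] H := A⁻
  have hNP : ∀ x, N (P x) = 0 := fun x => by
    have := CFC.negPart_mul_posPart A
    exact DFunLike.congr_fun this x
  have hPad : ContinuousLinearMap.adjoint P = P :=
    (IsSelfAdjoint.of_nonneg (CFC.posPart_nonneg A)).adjoint_eq
  let U : Submodule ℂ H := P.range.topologicalClosure
  have hU : IsClosed (U : Set H) := Submodule.isClosed_topologicalClosure _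
  have : CompleteSpace U := hU.completeSpace_coe
  have hNU : ∀ x ∈ U, N x = 0 := by
    have : U ≤ N.ker := by
      refine Submodule.topologicalClosure_minimal _ ?_ N.isClosed_ker
      rintro _ ⟨x, rfl⟩
      exact hNP x
    exact this
  obtain ⟨v, c, hc⟩ := exists_hilbertBasis ℂ U
  have hcon : Orthonormal ℂ (fun i : v => ((c i : U) : H)) :=
    c.orthonormal.comp_linearIsometry U.subtypeₗᵢ
  obtain ⟨w, b, hw, hb⟩ := hcon.toSubtypeRange.exists_hilbertBasis_extension
  refine ⟨w, b, fun i => ?_⟩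
  by_cases hi : (b i) ∈ Set.range (fun i : v => ((c i : U) : H))
  · right
    obtain ⟨j, hj⟩ := hi
    rw [← hj]
    exact hNU _ (c j).2
  · left
    have horth : ∀ j : v, ⟪((c j : U) : H), b i⟫_ℂ = 0 := by
      intro j
      have h1 : ((c j : U) : H) = b ⟨((c j : U) : H), hw ⟨j, rfl⟩⟩ := by rw [hb]
      rw [h1]
      refine b.orthonormal.2 ?_
      intro h
      apply hi
      refine ⟨j, ?_⟩
      rw [← h]
      exact h1
    have horthU : ∀ u : U, ⟪(u : H), b i⟫_ℂ = 0 := by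
      intro u
      have hs := c.hasSum_repr u
      have hs2 := (hs.mapL U.subtypeL)
      have hs3 := hs2.mapL (innerSL ℂ (b i))
      have : ⟪b i, (u : H)⟫_ℂ = 0 := by
        refine hs3.unique ?_
        convert hasSum_zero with j
        simp only [map_smul, innerSL_apply_apply, Submodule.subtypeL_apply]
        rw [← inner_conj_symm, horth j]
        simp
      rw [← inner_conj_symm, this]
      simp
    refine ext_inner_left ℂ fun y => ?_
    rw [inner_zero_right, ← hPad, ContinuousLinearMap.adjoint_inner_right]
    exact horthU ⟨P y, Submodule.le_topologicalClosure _ ⟨y, rfl⟩⟩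

lemma traceNorm_eq_supNorm {A : H →L[ℂ] H} (hA : IsSelfAdjoint A) :
    traceNorm A = supNorm A := by
  refine le_antisymm ?_ (supNorm_le_traceNorm hA)
  obtain ⟨w, b, hb⟩ := exists_adapted_basis A
  rw [traceNorm_eq hA, posTrace_eq_basis b (CFC.posPart_nonneg A),
    posTrace_eq_basis b (CFC.negPart_nonneg A), ← ENNReal.tsum_add]
  refine le_trans (le_of_eq ?_) (sum_le_supNorm A b.orthonormal)
  congr with i
  conv_rhs => rw [← CFC.posPart_sub_negPart A hA]
  rw [sub_apply, inner_sub_right]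
  rcases hb i with h | h <;> simp [h]

lemma traceNorm_add_le {A B : H →L[ℂ] H} (hA : IsSelfAdjoint A) (hB : IsSelfAdjoint B) :
    traceNorm (A + B) ≤ traceNorm A + traceNorm B := by
  rw [traceNorm_eq_supNorm hA, traceNorm_eq_supNorm hB, traceNorm_eq_supNorm (hA.add hB)]
  refine supNorm_le fun n e f he hf => ?_
  refine le_trans ?_ (add_le_add (le_supNorm A he hf) (le_supNorm B he hf))
  rw [← Finset.sum_add_distrib]
  refine Finset.sum_le_sum fun k _ => ?_
  rw [add_apply, inner_add_right]
  exact enorm_add_le _ _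

lemma traceNorm_zero : traceNorm (0 : H →L[ℂ] H) = 0 := by
  simp [traceNorm, posTrace]

lemma traceNorm_smul (c : ℝ) (A : H →L[ℂ] H) : traceNorm (c • A) = ‖c‖ₑ * traceNorm A := by
  unfold traceNorm posTrace
  rw [CFC.abs_smul, ← ENNReal.tsum_mul_left]
  congr with i
  rw [smul_apply, inner_smul_right_eq_smul, enorm_smul]
  simp

end Hilbert

section TraceClass
variable (H : Type*) [NormedAddCommGroup H] [InnerProductSpace ℂ H] [CompleteSpace H]

/-- The self-adjoint trace-class operators, as a real subspace of the bounded operators. -/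
def traceClassSubmodule : Submodule ℝ (H →L[ℂ] H) where
  carrier := {A | IsSelfAdjoint A ∧ traceNorm A ≠ ∞}
  zero_mem' := ⟨.zero _, by simp [traceNorm_zero]⟩
  add_mem' := by
    rintro A B ⟨hA, hA'⟩ ⟨hB, hB'⟩
    exact ⟨hA.add hB, ne_top_of_le_ne_top (ENNReal.add_ne_top.2 ⟨hA', hB'⟩)
      (traceNorm_add_le hA hB)⟩
  smul_mem' := by
    rintro c A ⟨hA, hA'⟩
    refine ⟨IsSelfAdjoint.smul (IsSelfAdjoint.all c) hA, ?_⟩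
    rw [traceNorm_smul]
    exact ENNReal.mul_ne_top (by simp) hA'

/-- The real vector space of self-adjoint trace-class operators on `H`; it carries the trace norm,
not the operator norm. -/
def SATraceClass : Type _ := traceClassSubmodule H

namespace SATraceClass

instance : AddCommGroup (SATraceClass H) := inferInstanceAs (AddCommGroup (traceClassSubmodule H))

instance : Module ℝ (SATraceClass H) := inferInstanceAs (Module ℝ (traceClassSubmodule H))

variable {H}

/-- The underlying bounded operator. -/
def op : SATraceClass H →ₗ[ℝ] (H →L[ℂ] H) := (traceClassSubmodule H).subtype

lemma op_injective : Function.Injective (op : SATraceClass H → (H →L[ℂ] H)) :=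
  Subtype.val_injective

lemma op_selfAdjoint (A : SATraceClass H) : IsSelfAdjoint (op A) := A.2.1

lemma op_traceNorm (A : SATraceClass H) : traceNorm (op A) ≠ ∞ := A.2.2

instance : Norm (SATraceClass H) := ⟨fun A => (traceNorm (op A)).toReal⟩

lemma norm_def (A : SATraceClass H) : ‖A‖ = (traceNorm (op A)).toReal := rfl

lemma norm_op_le (A : SATraceClass H) : ‖op A‖ ≤ ‖A‖ := by
  refine ContinuousLinearMap.opNorm_le_bound _ ENNReal.toReal_nonneg fun x => ?_
  have h := enorm_apply_le_supNorm (op A) x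
  rw [← traceNorm_eq_supNorm A.op_selfAdjoint] at h
  have h2 := ENNReal.toReal_mono (ENNReal.mul_ne_top A.op_traceNorm (by simp)) h
  simpa [norm_def] using h2

lemma core : NormedSpace.Core ℝ (SATraceClass H) where
  norm_nonneg _ := ENNReal.toReal_nonneg
  norm_smul c A := by
    rw [norm_def, norm_def, map_smul, traceNorm_smul, ENNReal.toReal_mul]
    simp
  norm_triangle A B := by
    rw [norm_def, norm_def, norm_def, map_add,
      ← ENNReal.toReal_add A.op_traceNorm B.op_traceNorm]
    exact ENNReal.toReal_mono (ENNReal.add_ne_top.2 ⟨A.op_traceNorm, B.op_traceNorm⟩)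
      (traceNorm_add_le A.op_selfAdjoint B.op_selfAdjoint)
  norm_eq_zero_iff A := by
    constructor
    · intro h
      have h1 := norm_op_le A
      rw [h] at h1
      have h2 : op A = 0 := norm_le_zero_iff.1 h1
      exact op_injective (by rw [h2, map_zero])
    · rintro rfl
      rw [norm_def, map_zero, traceNorm_zero, ENNReal.toReal_zero]

instance : NormedAddCommGroup (SATraceClass H) := NormedAddCommGroup.ofCore core

instance : NormedSpace ℝ (SATraceClass H) := NormedSpace.ofCore core

/-- The inclusion of the trace-class operators into the bounded operators is continuous. -/
def opL : SATraceClass H →L[ℝ] (H →L[ℂ] H) :=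
  LinearMap.mkContinuous op 1 (fun A => by simpa using norm_op_le A)

lemma opL_apply (A : SATraceClass H) : opL A = op A := rfl

instance : CompleteSpace (SATraceClass H) := by
  refine Metric.complete_of_cauchySeq_tendsto fun u hu => ?_
  have hc : CauchySeq (fun n => opL (u n)) := 
    (opL (H := H)).uniformContinuous.comp_cauchySeq hu
  obtain ⟨A, hA⟩ := cauchySeq_tendsto_of_complete hc
  have hsa : IsSelfAdjoint A := by
    have h1 : Filter.Tendsto (fun n => star (opL (u n))) Filter.atTop (nhds (star A)) :=
      (continuous_star.tendsto A).comp hA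
    refine tendsto_nhds_unique h1 ?_
    convert hA using 2 with n
    exact (u n).op_selfAdjoint
  have key : ∀ ε > 0, ∃ N, ∀ n ≥ N, traceNorm (op (u n) - A) ≤ ENNReal.ofReal ε := by
    intro ε hε
    obtain ⟨N, hN⟩ := Metric.cauchySeq_iff.1 hu ε hε
    refine ⟨N, fun n hn => ?_⟩
    rw [traceNorm_eq_supNorm ((u n).op_selfAdjoint.sub hsa)]
    refine supNorm_le fun k e f he hf => ?_
    have hlim : Filter.Tendsto (fun m => ∑ i, ‖⟪f i, (op (u n) - opL (u m)) (e i)⟫_ℂ‖ₑ)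
        Filter.atTop (nhds (∑ i, ‖⟪f i, (op (u n) - A) (e i)⟫_ℂ‖ₑ)) := by
      refine tendsto_finsetSum _ fun i _ => ?_
      suffices h : Filter.Tendsto (fun m => (op (u n) - opL (u m)) (e i)) Filter.atTop
          (nhds ((op (u n) - A) (e i))) from
        (Filter.Tendsto.inner (𝕜 := ℂ) (tendsto_const_nhds (x := f i)) h).enorm
      have : Filter.Tendsto (fun m => op (u n) - opL (u m)) Filter.atTop
          (nhds (op (u n) - A)) := tendsto_const_nhds.sub hA
      exact ((continuous_eval_const (F := H →L[ℂ] H) (e i)).tendsto (op (u n) - A)).comp this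
    refine le_of_tendsto hlim ?_
    filter_upwards [Filter.eventually_ge_atTop N] with m hm
    have h1 := hN n hn m hm
    rw [dist_eq_norm, norm_def, map_sub] at h1
    have h2 : traceNorm (op (u n) - op (u m)) ≤ ENNReal.ofReal ε := by
      have := (u n - u m).op_traceNorm
      rw [map_sub] at this
      exact (ENNReal.le_ofReal_iff_toReal_le this hε.le).2 h1.le
    refine le_trans ?_ h2
    rw [traceNorm_eq_supNorm ((u n).op_selfAdjoint.sub (u m).op_selfAdjoint)]
    exact le_supNorm _ he hf
  have hfin : traceNorm A ≠ ∞ := by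
    obtain ⟨N, hN⟩ := key 1 one_pos
    have h1 := hN N le_rfl
    have h2 : A = op (u N) + (-1 : ℝ) • (op (u N) - A) := by
      rw [neg_one_smul]; abel
    have h3 : IsSelfAdjoint ((-1 : ℝ) • (op (u N) - A)) :=
      IsSelfAdjoint.smul (IsSelfAdjoint.all _) ((u N).op_selfAdjoint.sub hsa)
    rw [h2]
    refine ne_top_of_le_ne_top ?_ (traceNorm_add_le (u N).op_selfAdjoint h3)
    rw [traceNorm_smul]
    exact ENNReal.add_ne_top.2 ⟨(u N).op_traceNorm,
      ENNReal.mul_ne_top (by simp) (ne_top_of_le_ne_top (by simp) h1)⟩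
  let a : SATraceClass H := ⟨A, hsa, hfin⟩
  refine ⟨a, Metric.tendsto_atTop.2 fun ε hε => ?_⟩
  obtain ⟨N, hN⟩ := key (ε / 2) (half_pos hε)
  refine ⟨N, fun n hn => ?_⟩
  rw [dist_eq_norm, norm_def, map_sub]
  have h1 := ENNReal.toReal_mono (by simp) (hN n hn)
  rw [ENNReal.toReal_ofReal (half_pos hε).le] at h1
  exact lt_of_le_of_lt h1 (half_lt_self hε)

end SATraceClass

variable {H}

lemma posTrace_eq_traceNorm {A : H →L[ℂ] H} (hA : 0 ≤ A) : traceNorm A = posTrace A := by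
  rw [traceNorm, CFC.abs_of_nonneg A hA]

lemma opTrace_of_nonneg {A : H →L[ℂ] H} (hA : 0 ≤ A) :
    opTrace A = ((posTrace A).toReal : ℂ) := by
  unfold opTrace posTrace
  rw [ENNReal.tsum_toReal_eq (by simp), Complex.ofReal_tsum]
  congr with i
  rw [toReal_enorm, ← inner_eq_ofReal hA]

lemma enorm_opTrace_of_nonneg {A : H →L[ℂ] H} (hA : 0 ≤ A) (h : posTrace A ≠ ∞) :
    ENNReal.ofReal (opTrace A).re = posTrace A := by
  rw [opTrace_of_nonneg hA, Complex.ofReal_re, ENNReal.ofReal_toReal h]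

/-- If `s = ∑ wᵢ vᵢ` with positive `vᵢ`, then so are the quadratic forms. -/
lemma nonneg_of_hasSum {w : ℕ → ℝ≥0} {v : ℕ → H →L[ℂ] H} {s : H →L[ℂ] H} (hv : ∀ i, 0 ≤ v i)
    (hs : HasSum (fun i => w i • v i) s) : 0 ≤ s :=
  hs.nonneg fun i => smul_nonneg (w i).2 (hv i)

lemma inner_of_hasSum {w : ℕ → ℝ≥0} {v : ℕ → H →L[ℂ] H} {s : H →L[ℂ] H} (hv : ∀ i, 0 ≤ v i)
    (hs : HasSum (fun i => w i • v i) s) (x : H) :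
    ‖⟪x, s x⟫_ℂ‖ₑ = ∑' i, (w i : ℝ≥0∞) * ‖⟪x, v i x⟫_ℂ‖ₑ := by
  have h0 := nonneg_of_hasSum hv hs
  have h1 : HasSum (fun i => ⟪x, (w i • v i) x⟫_ℂ) ⟪x, s x⟫_ℂ :=
    (hs.mapL (ContinuousLinearMap.apply ℂ H x)).mapL (innerSL ℂ x)
  have h2 : ∀ i, ⟪x, (w i • v i) x⟫_ℂ = (((w i : ℝ) * ‖⟪x, v i x⟫_ℂ‖ : ℝ) : ℂ) := by
    intro i
    rw [smul_apply, NNReal.smul_def, inner_smul_right_eq_smul, Complex.ofReal_mul,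
      ← inner_eq_ofReal (hv i)]
    simp
  simp_rw [h2] at h1
  rw [inner_eq_ofReal h0] at h1
  have h3 := Complex.hasSum_ofReal.1 h1
  rw [← ofReal_norm, ← h3.tsum_eq,
    ENNReal.ofReal_tsum_of_nonneg (fun i => by positivity) h3.summable]
  congr with i
  rw [ENNReal.ofReal_mul (by positivity), ofReal_norm, ENNReal.ofReal_coe_nnreal]

lemma posTrace_of_hasSum {w : ℕ → ℝ≥0} {v : ℕ → H →L[ℂ] H} {s : H →L[ℂ] H} (hv : ∀ i, 0 ≤ v i)
    (hs : HasSum (fun i => w i • v i) s) :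
    posTrace s = ∑' i, (w i : ℝ≥0∞) * posTrace (v i) := by
  unfold posTrace
  simp_rw [inner_of_hasSum hv hs, ← ENNReal.tsum_mul_left]
  exact ENNReal.tsum_comm

end TraceClass

section General

/-- A probabilistic theory: a σ-convex subset (the set of states) of a real Banach space. -/
structure ProbTheory (V : Type*) [NormedAddCommGroup V] [NormedSpace ℝ V] [CompleteSpace V] where
  states : Set V
  sigmaConvex : ∀ (w : ℕ → ℝ≥0) (v : ℕ → V), HasSum w 1 → (∀ i, v i ∈ states) →
    ∃ s ∈ states, HasSum (fun i => w i • v i) s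

variable {V : Type*} [NormedAddCommGroup V] [NormedSpace ℝ V] [CompleteSpace V]

/-- A σ-affine map from the states of `K` to the probability measures on `X`. -/
structure Observable (K : ProbTheory V) (X : Type*) [MeasurableSpace X] where
  toFun : K.states → ProbabilityMeasure X
  sigmaAffine : ∀ (w : ℕ → ℝ≥0) (v : ℕ → K.states) (s : K.states), HasSum w 1 →
    HasSum (fun i => w i • (v i : V)) (s : V) →
    (toFun s : Measure X) = Measure.sum fun i => w i • (toFun (v i) : Measure X)

variable {K : ProbTheory V}

/-- A finite family of (real) observables is compatible if it has a joint `n`-dimensional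
observable. -/
def Compatible {n : ℕ} (M : Fin n → Observable K ℝ) : Prop :=
  ∃ J : Observable K (Fin n → ℝ), ∀ (i : Fin n) (s : K.states) (A : Set ℝ), MeasurableSet A →
    (J.toFun s : Measure (Fin n → ℝ)) {x | x i ∈ A} = ((M i).toFun s : Measure ℝ) A

/-- The convex combination `t M + (1 - t) N` of observables. -/
def Observable.mix {X : Type*} [MeasurableSpace X] (t : unitInterval) (M N : Observable K X) :
    Observable K X where
  toFun s := ⟨unitInterval.toNNReal t • (M.toFun s : Measure X) +
    unitInterval.toNNReal (unitInterval.symm t) • (N.toFun s : Measure X), inferInstance⟩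
  sigmaAffine w v s hw hs := by
    simp only [ProbabilityMeasure.coe_mk]
    rw [M.sigmaAffine w v s hw hs, N.sigmaAffine w v s hw hs]
    refine Measure.ext fun A hA => ?_
    simp only [Measure.add_apply, Measure.smul_apply, Measure.sum_apply _ hA, ENNReal.smul_def,
      smul_eq_mul, smul_add, ENNReal.tsum_add, ← ENNReal.tsum_mul_left]
    congr 2 <;> ext i <;> ring

/-- The trivial observable `T_p`, with the constant value `p`. -/
def trivialObservable {X : Type*} [MeasurableSpace X] (p : ProbabilityMeasure X) :
    Observable K X where
  toFun _ := p
  sigmaAffine w _ _ hw _ := by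
    refine Measure.ext fun A hA => ?_
    simp only [Measure.smul_apply, Measure.sum_apply _ hA, ENNReal.smul_def, smul_eq_mul]
    rw [ENNReal.tsum_mul_right, ← ENNReal.coe_tsum hw.summable, hw.tsum_eq]
    simp

/-- The set of trivial observables on `K`. -/
def trivialObservables (K : ProbTheory V) : Set (Observable K ℝ) :=
  Set.range trivialObservable

/-- The compatibility interval `I(M, N)`. -/
def compatInterval (M N : Observable K ℝ) : Set ℝ :=
  {l | ∃ h : l ∈ Set.Icc (0 : ℝ) 1, ∃ T ∈ trivialObservables K,
    Compatible ![M, Observable.mix ⟨l, h⟩ N T]}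

/-- The index of compatibility `λ(M, N)` of two observables. -/
def compatIndex (M N : Observable K ℝ) : ℝ :=
  sSup (compatInterval M N)

/-- The interval of compatibility `I(K)` of a probabilistic theory. -/
def ProbTheory.interval (K : ProbTheory V) : Set ℝ :=
  ⋂ (M : Observable K ℝ) (N : Observable K ℝ), compatInterval M N

/-- The index of compatibility `λ(K)` of a probabilistic theory. -/
def ProbTheory.index (K : ProbTheory V) : ℝ :=
  sInf {l | ∃ M N : Observable K ℝ, l = compatIndex M N}

end General

section Quantum
variable {H : Type*} [NormedAddCommGroup H] [InnerProductSpace ℂ H] [CompleteSpace H]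

open SATraceClass

lemma posTrace_state {s : H →L[ℂ] H} (hs : 0 ≤ s) (ht : opTrace s = 1) : posTrace s = 1 := by
  rw [opTrace_of_nonneg hs, Complex.ofReal_eq_one, ENNReal.toReal_eq_one_iff] at ht
  exact ht

variable (H) in
/-- Quantum theory on `H`: the states are the positive operators of trace one, in the Banach space
of self-adjoint trace-class operators with the trace norm. -/
def quantumTheory : ProbTheory (SATraceClass H) where
  states := {s | 0 ≤ op s ∧ opTrace (op s) = 1}
  sigmaConvex w v hw hv := by
    have hnorm : ∀ i, ‖v i‖ = 1 := fun i => by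
      rw [norm_def, posTrace_eq_traceNorm (hv i).1, posTrace_state (hv i).1 (hv i).2,
        ENNReal.toReal_one]
    have hsum : Summable (fun i => w i • v i) := by
      refine Summable.of_norm_bounded (g := fun i => (w i : ℝ))
        (NNReal.summable_coe.2 hw.summable) fun i => ?_
      rw [NNReal.smul_def, norm_smul, hnorm]
      simp
    obtain ⟨s, hs⟩ := hsum
    have hop : HasSum (fun i => w i • op (v i)) (op s) := by
      have := hs.mapL opL
      simpa only [NNReal.smul_def, map_smul, opL_apply] using this
    have h0 : 0 ≤ op s := nonneg_of_hasSum (fun i => (hv i).1) hop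
    refine ⟨s, ⟨h0, ?_⟩, hs⟩
    rw [opTrace_of_nonneg h0, posTrace_of_hasSum (fun i => (hv i).1) hop]
    simp_rw [fun i => posTrace_state (hv i).1 (hv i).2, mul_one]
    rw [← ENNReal.coe_tsum hw.summable, hw.tsum_eq]
    simp

/-- A (normalized) positive operator-valued measure on the Borel sets of the real line; countable
additivity is in the weak sense. -/
structure POVM (H : Type*) [NormedAddCommGroup H] [InnerProductSpace ℂ H] [CompleteSpace H] where
  toFun : Set ℝ → (H →L[ℂ] H)
  nonneg : ∀ A, MeasurableSet A → 0 ≤ toFun A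
  map_univ : toFun Set.univ = 1
  map_iUnion : ∀ A : ℕ → Set ℝ, (∀ i, MeasurableSet (A i)) →
    Pairwise (Function.onFun Disjoint A) →
    ∀ ψ : H, HasSum (fun i => ⟪ψ, toFun (A i) ψ⟫_ℂ) ⟪ψ, toFun (⋃ i, A i) ψ⟫_ℂ

lemma conj_nonneg {E : H →L[ℂ] H} (hE : 0 ≤ E) (T : H →L[ℂ] H) :
    0 ≤ CFC.sqrt T * E * CFC.sqrt T :=
  (IsSelfAdjoint.of_nonneg (CFC.sqrt_nonneg T)).conjugate_nonneg hE

lemma inner_conj (s E : H →L[ℂ] H) (x y : H) :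
    ⟪x, (CFC.sqrt s * E * CFC.sqrt s) y⟫_ℂ = ⟪CFC.sqrt s x, E (CFC.sqrt s y)⟫_ℂ := by
  rw [mul_assoc, mul_apply_eq_comp, mul_apply_eq_comp, ← ContinuousLinearMap.adjoint_inner_left,
    sqrt_adjoint]

lemma posTrace_conj {s E : H →L[ℂ] H} (hE : 0 ≤ E) :
    posTrace (CFC.sqrt s * E * CFC.sqrt s) =
      ∑' i, ‖(CFC.sqrt E * CFC.sqrt s) (basis H i)‖ₑ ^ 2 := by
  unfold posTrace
  congr with i
  rw [inner_conj, enorm_inner_sqrt hE]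
  rfl

lemma posTrace_conj_comm {s E : H →L[ℂ] H} (hs : 0 ≤ s) (hE : 0 ≤ E) :
    posTrace (CFC.sqrt s * E * CFC.sqrt s) = posTrace (CFC.sqrt E * s * CFC.sqrt E) := by
  rw [posTrace_conj hE, posTrace_conj hs, hs_adjoint (basis H) (basis H)]
  have : ContinuousLinearMap.adjoint (CFC.sqrt E * CFC.sqrt s) = CFC.sqrt s * CFC.sqrt E := by
    rw [← ContinuousLinearMap.star_eq_adjoint, star_mul, ContinuousLinearMap.star_eq_adjoint,
      ContinuousLinearMap.star_eq_adjoint, sqrt_adjoint, sqrt_adjoint]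
  rw [this]

lemma hs_mul_le (T R : H →L[ℂ] H) :
    ∑' i, ‖(T * R) (basis H i)‖ₑ ^ 2 ≤ ‖T‖ₑ ^ 2 * ∑' i, ‖R (basis H i)‖ₑ ^ 2 := by
  rw [← ENNReal.tsum_mul_left]
  refine ENNReal.tsum_le_tsum fun i => ?_
  rw [← mul_pow]
  gcongr
  exact T.le_opENorm _

lemma posTrace_eq_hs {s : H →L[ℂ] H} (hs : 0 ≤ s) :
    posTrace s = ∑' i, ‖CFC.sqrt s (basis H i)‖ₑ ^ 2 := by
  unfold posTrace
  simp_rw [enorm_inner_sqrt hs]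

lemma posTrace_conj_ne_top {s E : H →L[ℂ] H} (hs : 0 ≤ s) (hE : 0 ≤ E) (h : posTrace s ≠ ∞) :
    posTrace (CFC.sqrt s * E * CFC.sqrt s) ≠ ∞ := by
  rw [posTrace_conj hE]
  refine ne_top_of_le_ne_top ?_ (hs_mul_le _ _)
  rw [← posTrace_eq_hs hs]
  exact ENNReal.mul_ne_top (by simp) h

lemma trace_swap {ι : Type*} (b : HilbertBasis ι ℂ H) {r T : H →L[ℂ] H}
    (hr : ∀ x y, ⟪r x, y⟫_ℂ = ⟪x, r y⟫_ℂ)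
    (h1 : ∑' i, ‖r (b i)‖ₑ ^ 2 ≠ ∞) (h2 : ∑' i, ‖T (b i)‖ₑ ^ 2 ≠ ∞) :
    ∑' i, ⟪b i, (r * T) (b i)⟫_ℂ = ∑' j, ⟪b j, (T * r) (b j)⟫_ℂ := by
  have toSum : ∀ f : ι × ι → ℂ, ∑' p, ‖f p‖ₑ ^ 2 ≠ ∞ → Summable (fun p => ‖f p‖ ^ 2) := by
    intro f hf
    have := ENNReal.summable_toReal hf
    simpa using this
  have hF : Summable (fun p : ι × ι => ‖⟪b p.1, r (b p.2)⟫_ℂ‖ ^ 2) := by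
    refine toSum _ ?_
    rw [ENNReal.tsum_prod', ENNReal.tsum_comm]
    simpa only [parseval b] using h1
  have hG : Summable (fun p : ι × ι => ‖⟪b p.2, T (b p.1)⟫_ℂ‖ ^ 2) := by
    refine toSum _ ?_
    rw [ENNReal.tsum_prod']
    simpa only [parseval b] using h2
  have hFG : Summable (fun p : ι × ι => ⟪b p.1, r (b p.2)⟫_ℂ * ⟪b p.2, T (b p.1)⟫_ℂ) := by
    refine Summable.of_norm_bounded (hF.add hG) fun p => ?_
    rw [norm_mul]
    nlinarith [sq_nonneg (‖⟪b p.1, r (b p.2)⟫_ℂ‖ - ‖⟪b p.2, T (b p.1)⟫_ℂ‖),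
      sq_nonneg ‖⟪b p.1, r (b p.2)⟫_ℂ‖, sq_nonneg ‖⟪b p.2, T (b p.1)⟫_ℂ‖]
  have hl : ∀ i, ⟪b i, (r * T) (b i)⟫_ℂ = ∑' j, ⟪b i, r (b j)⟫_ℂ * ⟪b j, T (b i)⟫_ℂ := by
    intro i
    rw [mul_apply_eq_comp, ← hr, ← b.tsum_inner_mul_inner]
    simp_rw [hr]
  have hrr : ∀ j, ⟪b j, (T * r) (b j)⟫_ℂ = ∑' i, ⟪b i, r (b j)⟫_ℂ * ⟪b j, T (b i)⟫_ℂ := by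
    intro j
    rw [mul_apply_eq_comp, ← ContinuousLinearMap.adjoint_inner_left, ← b.tsum_inner_mul_inner]
    simp_rw [ContinuousLinearMap.adjoint_inner_left, mul_comm]
  simp_rw [hl, hrr]
  exact (Summable.tsum_comm (f := fun i j => ⟪b i, r (b j)⟫_ℂ * ⟪b j, T (b i)⟫_ℂ) hFG).symm

/-- Cyclicity of the trace: `tr (s E) = tr (√s E √s)` for a positive trace-class `s`. -/
lemma opTrace_mul {s : H →L[ℂ] H} (E : H →L[ℂ] H) (hs : 0 ≤ s) (h : posTrace s ≠ ∞) :
    opTrace (s * E) = opTrace (CFC.sqrt s * E * CFC.sqrt s) := by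
  rw [posTrace_eq_hs hs] at h
  have h2 : ∑' i, ‖(CFC.sqrt s * E) (basis H i)‖ₑ ^ 2 ≠ ∞ := by
    have h3 : ContinuousLinearMap.adjoint (CFC.sqrt s * E) =
        ContinuousLinearMap.adjoint E * CFC.sqrt s := by
      rw [← ContinuousLinearMap.star_eq_adjoint, star_mul, ContinuousLinearMap.star_eq_adjoint,
        ContinuousLinearMap.star_eq_adjoint, sqrt_adjoint]
    rw [hs_adjoint (basis H) (basis H), h3]
    exact ne_top_of_le_ne_top (ENNReal.mul_ne_top (by simp) h) (hs_mul_le _ _)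
  have h4 := trace_swap (basis H) (r := CFC.sqrt s) (T := CFC.sqrt s * E)
    (fun x y => by rw [← ContinuousLinearMap.adjoint_inner_left, sqrt_adjoint]) h h2
  rw [← mul_assoc, CFC.sqrt_mul_sqrt_self s hs] at h4
  exact h4

lemma ofReal_opTrace_mul {s E : H →L[ℂ] H} (hs : 0 ≤ s) (hE : 0 ≤ E) (h : posTrace s ≠ ∞) :
    ENNReal.ofReal (opTrace (s * E)).re = posTrace (CFC.sqrt s * E * CFC.sqrt s) := by
  rw [opTrace_mul E hs h, enorm_opTrace_of_nonneg (conj_nonneg hE s) (posTrace_conj_ne_top hs hE h)]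

lemma POVM.enorm_iUnion (P : POVM H) (A : ℕ → Set ℝ) (hA : ∀ i, MeasurableSet (A i))
    (hd : Pairwise (Function.onFun Disjoint A)) (ψ : H) :
    ‖⟪ψ, P.toFun (⋃ i, A i) ψ⟫_ℂ‖ₑ = ∑' i, ‖⟪ψ, P.toFun (A i) ψ⟫_ℂ‖ₑ := by
  have h1 := P.map_iUnion A hA hd ψ
  rw [inner_eq_ofReal (P.nonneg _ (MeasurableSet.iUnion hA))] at h1
  rw [funext fun i => inner_eq_ofReal (P.nonneg _ (hA i)) ψ] at h1
  have h3 := Complex.hasSum_ofReal.1 h1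
  rw [← ofReal_norm, ← h3.tsum_eq,
    ENNReal.ofReal_tsum_of_nonneg (fun i => norm_nonneg _) h3.summable]
  simp

/-- The outcome distribution `A ↦ tr (s P(A))` of a POVM in the state `s`. -/
def POVM.dist (P : POVM H) (s : (quantumTheory H).states) : Measure ℝ :=
  Measure.ofMeasurable
    (fun A _ => ENNReal.ofReal (opTrace (op (s : SATraceClass H) * P.toFun A)).re)
    (by
      have h1 := P.enorm_iUnion (fun _ => ∅) (by simp) (fun _ _ _ => by simp [Function.onFun])
      have h2 : ∀ ψ, ‖⟪ψ, P.toFun ∅ ψ⟫_ℂ‖ₑ = 0 := by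
        intro ψ
        have h3 := P.map_iUnion (fun _ => ∅) (by simp) (fun _ _ _ => by simp [Function.onFun]) ψ
        have h4 := (summable_const_iff _).1 h3.summable
        simp [h4]
      rw [ofReal_opTrace_mul s.2.1 (P.nonneg _ .empty)
        (by rw [posTrace_state s.2.1 s.2.2]; simp)]
      unfold posTrace
      simp_rw [inner_conj, h2]
      simp)
    (by
      intro A hA hd
      have hfin : posTrace (op (s : SATraceClass H)) ≠ ∞ := by
        rw [posTrace_state s.2.1 s.2.2]; simp
      rw [ofReal_opTrace_mul s.2.1 (P.nonneg _ (MeasurableSet.iUnion hA)) hfin]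
      simp_rw [fun i => ofReal_opTrace_mul s.2.1 (P.nonneg _ (hA i)) hfin]
      unfold posTrace
      simp_rw [inner_conj, P.enorm_iUnion A hA hd]
      exact ENNReal.tsum_comm)

lemma POVM.dist_apply (P : POVM H) (s : (quantumTheory H).states) {A : Set ℝ}
    (hA : MeasurableSet A) :
    P.dist s A = ENNReal.ofReal (opTrace (op (s : SATraceClass H) * P.toFun A)).re :=
  Measure.ofMeasurable_apply _ hA

/-- The observable `s ↦ (A ↦ tr (s P(A)))` on quantum theory given by a POVM `P`. -/
def POVM.observable (P : POVM H) : Observable (quantumTheory H) ℝ where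
  toFun s := ⟨P.dist s, ⟨by
    rw [P.dist_apply s .univ, P.map_univ, mul_one, s.2.2]
    simp⟩⟩
  sigmaAffine w v s hw hs := by
    simp only [ProbabilityMeasure.coe_mk]
    refine Measure.ext fun A hA => ?_
    have hop : HasSum (fun i => w i • op (v i : SATraceClass H)) (op (s : SATraceClass H)) := by
      have := hs.mapL opL
      simpa only [NNReal.smul_def, map_smul, opL_apply] using this
    have hfin : ∀ s : (quantumTheory H).states, posTrace (op (s : SATraceClass H)) ≠ ∞ := by
      intro s
      rw [posTrace_state s.2.1 s.2.2]; simp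
    have hP := P.nonneg A hA
    simp only [Measure.smul_apply, Measure.sum_apply _ hA, ENNReal.smul_def, smul_eq_mul,
      P.dist_apply _ hA]
    simp_rw [fun s : (quantumTheory H).states => ofReal_opTrace_mul s.2.1 hP (hfin s),
      fun s : (quantumTheory H).states => posTrace_conj_comm s.2.1 hP]
    unfold posTrace
    simp_rw [inner_conj, inner_of_hasSum (fun i => (v i).2.1) hop, ← ENNReal.tsum_mul_left]
    exact ENNReal.tsum_comm

/-- The Pauli matrix `σ_x`. -/
def pauliX : Matrix (Fin 2) (Fin 2) ℂ := !![0, 1; 1, 0]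

/-- The Pauli matrix `σ_y`. -/
def pauliY : Matrix (Fin 2) (Fin 2) ℂ := !![0, -Complex.I; Complex.I, 0]

/-- The operator on `H` with matrix `A` in the orthonormal pair `e` on the span of `e`, and zero
on the orthogonal complement of that span. -/
def extendOp (e : Fin 2 → H) (A : Matrix (Fin 2) (Fin 2) ℂ) : H →L[ℂ] H :=
  ∑ i, ∑ j, A i j • InnerProductSpace.rankOne ℂ (e i) (e j)

lemma extendOp_apply (e : Fin 2 → H) (A : Matrix (Fin 2) (Fin 2) ℂ) (x : H) :
    extendOp e A x = ∑ i, ∑ j, (A i j * ⟪e j, x⟫_ℂ) • e i := by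
  simp [extendOp, mul_smul]

lemma extendOp_mul {e : Fin 2 → H} (he : Orthonormal ℂ e) (A B : Matrix (Fin 2) (Fin 2) ℂ) :
    extendOp e A * extendOp e B = extendOp e (A * B) := by
  ext x
  rw [orthonormal_iff_ite] at he
  simp only [mul_apply_eq_comp, extendOp_apply, Fin.sum_univ_two, inner_add_right,
    inner_smul_right, he, Matrix.mul_apply]
  simp
  module

lemma extendOp_star (e : Fin 2 → H) (A : Matrix (Fin 2) (Fin 2) ℂ) :
    star (extendOp e A) = extendOp e A.conjTranspose := by
  rw [ContinuousLinearMap.star_eq_adjoint]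
  refine ContinuousLinearMap.ext fun x => ext_inner_left ℂ fun y => ?_
  rw [ContinuousLinearMap.adjoint_inner_right]
  simp only [extendOp_apply, Fin.sum_univ_two, inner_add_right, inner_add_left,
    inner_smul_right, inner_smul_left, Matrix.conjTranspose_apply, map_mul, inner_conj_symm]
  simp
  ring

lemma extendOp_bound {e : Fin 2 → H} (he : Orthonormal ℂ e) {A : Matrix (Fin 2) (Fin 2) ℂ}
    (hA : A.IsHermitian) (hA2 : A * A = 1) (c : ℝ) (hc : c * c = 1) :
    0 ≤ 1 + (c : ℂ) • extendOp e A := by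
  set S := extendOp e A
  set P := extendOp e 1
  have hSS : S * S = P := by rw [extendOp_mul he, hA2]
  have hPP : P * P = P := by rw [extendOp_mul he, one_mul]
  have hPS : P * S = S := by rw [extendOp_mul he, one_mul]
  have hSP : S * P = S := by rw [extendOp_mul he, mul_one]
  have hS : star S = S := by rw [extendOp_star, hA.eq]
  have hP : star P = P := by rw [extendOp_star, Matrix.conjTranspose_one]
  have h1 : 1 + (c : ℂ) • S = star (1 - P) * (1 - P) +
      (1 / 2 : ℝ) • (star (P + (c : ℂ) • S) * (P + (c : ℂ) • S)) := by
    rcases mul_self_eq_one_iff.1 hc with rfl | rfl <;>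
    · simp only [star_sub, star_one, star_add, star_neg, hS, hP, sub_mul, mul_sub, add_mul,
        mul_add, one_mul, mul_one, hSS, hPP, hPS, hSP, Complex.ofReal_one, Complex.ofReal_neg,
        one_smul, neg_smul, neg_mul, mul_neg]
      module
  rw [h1]
  exact add_nonneg (star_mul_self_nonneg _)
    (smul_nonneg (by norm_num) (star_mul_self_nonneg _))

lemma indicator_hasSum (A : ℕ → Set ℝ) (hd : Pairwise (Function.onFun Disjoint A)) (x : ℝ) :
    HasSum (fun i => (A i).indicator (1 : ℝ → ℂ) x) ((⋃ i, A i).indicator (1 : ℝ → ℂ) x) := by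
  by_cases hx : x ∈ ⋃ i, A i
  · obtain ⟨i, hi⟩ := Set.mem_iUnion.1 hx
    rw [Set.indicator_of_mem hx]
    convert hasSum_single (f := fun i => (A i).indicator (1 : ℝ → ℂ) x) i ?_ using 1
    · rw [Set.indicator_of_mem hi]
    · intro j hj
      exact Set.indicator_of_notMem (fun h => (Set.disjoint_left.1 (hd hj) h) hi) _
  · rw [Set.indicator_of_notMem hx]
    convert hasSum_zero with i
    exact Set.indicator_of_notMem (fun h => hx (Set.mem_iUnion.2 ⟨i, h⟩)) _

open scoped ComplexOrder in
/-- The two-valued POVM `P(±1) = (I ± S) / 2`, with `S` the extension to `H` of a Hermitian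
involutive `2 × 2` matrix `A`. -/
def spinPOVM (e : Fin 2 → H) (he : Orthonormal ℂ e) (A : Matrix (Fin 2) (Fin 2) ℂ)
    (hA : A.IsHermitian) (hA2 : A * A = 1) : POVM H where
  toFun B := B.indicator (1 : ℝ → ℂ) 1 • ((1 / 2 : ℂ) • (1 + extendOp e A)) +
    B.indicator (1 : ℝ → ℂ) (-1) • ((1 / 2 : ℂ) • (1 - extendOp e A))
  nonneg B _ := by
    have h1 := extendOp_bound he hA hA2 1 (by norm_num)
    have h2 := extendOp_bound he hA hA2 (-1) (by norm_num)
    simp only [Complex.ofReal_one, one_smul, Complex.ofReal_neg, neg_smul, ← sub_eq_add_neg]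
      at h1 h2
    have h0 : ∀ x : ℝ, 0 ≤ B.indicator (1 : ℝ → ℂ) x := fun x =>
      Set.indicator_nonneg (fun _ _ => zero_le_one) x
    have hh : (0 : ℂ) ≤ 1 / 2 := by
      rw [show (1 / 2 : ℂ) = ((1 / 2 : ℝ) : ℂ) by push_cast; rfl]
      exact Complex.zero_le_real.2 (by norm_num)
    rw [ContinuousLinearMap.nonneg_iff_isPositive] at h1 h2 ⊢
    exact ((h1.smul_of_nonneg hh).smul_of_nonneg (h0 1)).add
      ((h2.smul_of_nonneg hh).smul_of_nonneg (h0 (-1)))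
  map_univ := by
    simp only [Set.indicator_univ, Pi.one_apply, one_smul]
    module
  map_iUnion B _ hd ψ := by
    simp only [add_apply, smul_apply, inner_add_right, inner_smul_right]
    exact ((indicator_hasSum B hd 1).mul_right _).add ((indicator_hasSum B hd (-1)).mul_right _)

lemma pauliX_isHermitian : pauliX.IsHermitian := by
  ext i j
  fin_cases i <;> fin_cases j <;> simp [pauliX]

lemma pauliY_isHermitian : pauliY.IsHermitian := by
  ext i j
  fin_cases i <;> fin_cases j <;> simp [pauliY]

lemma pauliX_sq : pauliX * pauliX = 1 := by
  ext i j
  fin_cases i <;> fin_cases j <;> simp [pauliX, Matrix.mul_apply, Fin.sum_univ_two]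

lemma pauliY_sq : pauliY * pauliY = 1 := by
  ext i j
  fin_cases i <;> fin_cases j <;> simp [pauliY, Matrix.mul_apply, Fin.sum_univ_two]

/-- The observable `M_x` of the POVM `M_x(±1) = (I ± σ_x) / 2`, with `σ_x` extended by zero from the
span of the orthonormal pair `e`. -/
def obsX (e : Fin 2 → H) (he : Orthonormal ℂ e) : Observable (quantumTheory H) ℝ :=
  (spinPOVM e he pauliX pauliX_isHermitian pauliX_sq).observable

/-- The observable `M_y` of the POVM `M_y(±1) = (I ± σ_y) / 2`, with `σ_y` extended by zero from the
span of the orthonormal pair `e`. -/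
def obsY (e : Fin 2 → H) (he : Orthonormal ℂ e) : Observable (quantumTheory H) ℝ :=
  (spinPOVM e he pauliY pauliY_isHermitian pauliY_sq).observable

end Quantum

end GPT

end

/-! Only the equatorial states of the span of `e` matter: the pure states of (e₀ + z e₁)/√2 with |z|
= 1. Their density operators are real-affine in z, so their mixtures form a disc. In them M_x and
M_y give the outcome 1 with probabilities (1 + Re z)/2 and (1 + Im z)/2.

Let J be a joint observable of M_x and μ M_y + (1 - μ) T, where T has the constant value p. Let p₊
and p₋ be the J-probabilities that the second outcome is 1 while the first is 1, respectively is not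
1. Both are affine on the disc with values in [0, 1]; p₊ vanishes at z = -1 and p₋ at z = 1. A
nonnegative affine function that vanishes at a boundary point of the disc is constant along the
tangent there. Both tangents are vertical, so p₊ + p₋ does not depend on Im z. But this sum is μ (1
+ Im z)/2 + (1 - μ) p{1}, hence μ = 0, whatever p is.

The tangency is used quantitatively: `real_equatorState_le` bounds p₊ and p₋ near their zeros to
second order, and `eq_zero_of_compatible_mix` compares this with the first-order change of the sum.
Conversely, product measures join any observable to a trivial one (`compatible_mix_zero`). So 0 lies
in every compatibility interval and no index is negative; the single pair M_x, M_y then settles the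
interval, the index and its minimality. -/

namespace GPT

/-! ### Binary mixtures of states and affinity of observables. -/

section General
variable {V : Type*} [NormedAddCommGroup V] [NormedSpace ℝ V] [CompleteSpace V] {K : ProbTheory V}

/-- The weights `t, 1 - t, 0, 0, …`. -/
noncomputable def pairWeights (t : unitInterval) (i : ℕ) : ℝ≥0 :=
  if i = 0 then unitInterval.toNNReal t else
    if i = 1 then unitInterval.toNNReal (unitInterval.symm t) else 0

lemma hasSum_pairWeights_smul {E : Type*} [AddCommMonoid E] [TopologicalSpace E] [Module ℝ≥0 E]
    (t : unitInterval) (v : ℕ → E) :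
    HasSum (fun i => pairWeights t i • v i)
      (unitInterval.toNNReal t • v 0 + unitInterval.toNNReal (unitInterval.symm t) • v 1) := by
  have h := hasSum_sum_of_ne_finset_zero (L := .unconditional ℕ) (s := Finset.range 2)
    (f := fun i => pairWeights t i • v i) (fun i hi => by
      have h0 : i ≠ 0 := by rintro rfl; simp at hi
      have h1 : i ≠ 1 := by rintro rfl; simp at hi
      simp [pairWeights, h0, h1])
  simpa [Finset.sum_range_succ, pairWeights] using h

lemma hasSum_pairWeights (t : unitInterval) : HasSum (pairWeights t) 1 := by
  have h := hasSum_pairWeights_smul t (fun _ => (1 : ℝ≥0))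
  convert h using 1
  · ext i; simp
  · ext; simp

/-- σ-convexity is applied to a sequence with only two nonzero weights; uniqueness of the limit
identifies the state it provides with the two-term combination. -/
lemma ProbTheory.mix_mem (K : ProbTheory V) {a b : V} (ha : a ∈ K.states) (hb : b ∈ K.states)
    (t : unitInterval) : (t : ℝ) • a + (1 - (t : ℝ)) • b ∈ K.states := by
  obtain ⟨s, hs, h⟩ := K.sigmaConvex (pairWeights t) (fun i => if i = 0 then a else b)
    (hasSum_pairWeights t) (fun i => by split_ifs <;> assumption)
  have := h.unique (hasSum_pairWeights_smul t _)
  simp only [if_true, one_ne_zero, if_false, NNReal.smul_def, unitInterval.coe_toNNReal,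
    unitInterval.coe_symm_eq] at this
  rwa [← this]

/-- An observable is affine. -/
lemma Observable.real_mix {X : Type*} [MeasurableSpace X] (J : Observable K X) {B : Set X}
    (hB : MeasurableSet B) (a b s : K.states) (t : unitInterval)
    (hs : (s : V) = (t : ℝ) • (a : V) + (1 - (t : ℝ)) • (b : V)) :
    (J.toFun s : Measure X).real B =
      t * (J.toFun a : Measure X).real B + (1 - t) * (J.toFun b : Measure X).real B := by
  have h := J.sigmaAffine (pairWeights t) (fun i => if i = 0 then a else b) s
    (hasSum_pairWeights t) (by
      rw [hs]
      simpa [NNReal.smul_def] using hasSum_pairWeights_smul t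
        (fun i => (((if i = 0 then a else b : K.states)) : V)))
  have h2 : (J.toFun s : Measure X) B = unitInterval.toNNReal t • (J.toFun a : Measure X) B +
      unitInterval.toNNReal (unitInterval.symm t) • (J.toFun b : Measure X) B := by
    rw [h, Measure.sum_apply _ hB]
    have := hasSum_pairWeights_smul t
      (fun i => (J.toFun (if i = 0 then a else b) : Measure X) B)
    simpa using this.tsum_eq
  rw [measureReal_def, h2, ENNReal.smul_def, ENNReal.smul_def, smul_eq_mul, smul_eq_mul,
    ENNReal.toReal_add (by finiteness) (by finiteness)]
  simp [measureReal_def]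

/-- Two convex decompositions of the same state give the same average of outcome
probabilities. -/
lemma Observable.real_mix_eq {X : Type*} [MeasurableSpace X] (J : Observable K X) {B : Set X}
    (hB : MeasurableSet B) (a b c d : K.states) (t u : unitInterval)
    (h : (t : ℝ) • (a : V) + (1 - (t : ℝ)) • (b : V) =
      (u : ℝ) • (c : V) + (1 - (u : ℝ)) • (d : V)) :
    t * (J.toFun a : Measure X).real B + (1 - t) * (J.toFun b : Measure X).real B =
      u * (J.toFun c : Measure X).real B + (1 - u) * (J.toFun d : Measure X).real B := by
  -- Both sides are the probability of `B` in one and the same state, so the membership proof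
  -- obtained from `a` and `b` also serves for the decomposition into `c` and `d`.
  rw [← J.real_mix hB a b ⟨_, K.mix_mem a.2 b.2 t⟩ t rfl, ← J.real_mix hB c d ⟨_, K.mix_mem a.2 b.2 t⟩ u h]

/-! ### Compatibility with trivial observables, and its consequences for the indices. -/

/-- The joint observable of `M` and the trivial observable with value `p`. -/
noncomputable def Observable.prodTrivial (M : Observable K ℝ) (p : ProbabilityMeasure ℝ) :
    Observable K (Fin 2 → ℝ) where
  toFun s := ⟨((M.toFun s : Measure ℝ).prod (p : Measure ℝ)).map
      (MeasurableEquiv.finTwoArrow (α := ℝ)).symm,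
    Measure.isProbabilityMeasure_map (MeasurableEquiv.measurable _).aemeasurable⟩
  sigmaAffine w v s hw hs := by
    simp only [ProbabilityMeasure.coe_mk]
    rw [M.sigmaAffine w v s hw hs]
    refine Measure.ext fun A hA => ?_
    rw [Measure.map_apply (MeasurableEquiv.measurable _) hA, Measure.sum_apply _ hA]
    have hA' : MeasurableSet ((MeasurableEquiv.finTwoArrow (α := ℝ)).symm ⁻¹' A) :=
      (MeasurableEquiv.measurable _) hA
    -- The product measure of a set is the integral of its section measures against the first
    -- factor, and that integral respects countable sums and scalar multiples of the factor.
    rw [Measure.prod_apply hA', lintegral_sum_measure]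
    refine tsum_congr fun i => ?_
    rw [Measure.smul_apply, Measure.map_apply (MeasurableEquiv.measurable _) hA,
      Measure.prod_apply hA', lintegral_smul_measure]

lemma mix_zero {X : Type*} [MeasurableSpace X] (N T : Observable K X) (s : K.states) :
    ((Observable.mix 0 N T).toFun s : Measure X) = T.toFun s := by
  simp [Observable.mix]

/-- At weight 0 the second observable ignores the state, so independent outcomes give a joint
observable; σ-affinity survives because only one factor varies. -/
lemma compatible_mix_zero (M N : Observable K ℝ) {T : Observable K ℝ}
    (hT : T ∈ trivialObservables K) : Compatible ![M, Observable.mix 0 N T] := by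
  obtain ⟨p, rfl⟩ := hT
  refine ⟨M.prodTrivial p, fun i s A hA => ?_⟩
  have hm : Measurable (MeasurableEquiv.finTwoArrow (α := ℝ)).symm := MeasurableEquiv.measurable _
  have hi : MeasurableSet {x : Fin 2 → ℝ | x i ∈ A} := measurable_pi_apply i hA
  simp only [Observable.prodTrivial, ProbabilityMeasure.coe_mk]
  rw [Measure.map_apply hm hi]
  fin_cases i
  · have : (MeasurableEquiv.finTwoArrow (α := ℝ)).symm ⁻¹' {x | x 0 ∈ A} = A ×ˢ Set.univ := by
      ext x; simp
    simp only [Fin.zero_eta, this, Measure.prod_prod]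
    simp
  · have : (MeasurableEquiv.finTwoArrow (α := ℝ)).symm ⁻¹' {x | x 1 ∈ A} = Set.univ ×ˢ A := by
      ext x; simp
    simp only [Fin.mk_one, this, Measure.prod_prod]
    simp [mix_zero, trivialObservable]

lemma zero_mem_compatInterval (M N : Observable K ℝ) : (0 : ℝ) ∈ compatInterval M N :=
  ⟨⟨le_rfl, zero_le_one⟩, _, ⟨⟨Measure.dirac 0, inferInstance⟩, rfl⟩,
    compatible_mix_zero M N ⟨_, rfl⟩⟩

lemma compatIndex_nonneg (M N : Observable K ℝ) : 0 ≤ compatIndex M N :=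
  Real.sSup_nonneg fun _ hl => hl.1.1

/-- This carries the minimality claim. Nonnegativity of all elements is enough for the real infimum,
with no case distinction for an empty set. -/
lemma ProbTheory.index_nonneg (K : ProbTheory V) : 0 ≤ K.index :=
  Real.sInf_nonneg fun _ ⟨M, N, hl⟩ => hl ▸ compatIndex_nonneg M N

/-- One extreme pair suffices, since 0 belongs to the interval of every other pair. -/
lemma ProbTheory.interval_eq_zero {M N : Observable K ℝ} (h : compatInterval M N = {0}) :
    K.interval = {0} := by
  refine subset_antisymm (fun l hl => ?_) (Set.singleton_subset_iff.2 ?_)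
  · have hl' : l ∈ compatInterval M N := Set.mem_iInter.1 (Set.mem_iInter.1 hl M) N
    rwa [h] at hl'
  · exact Set.mem_iInter.2 fun M => Set.mem_iInter.2 fun N => zero_mem_compatInterval M N

lemma ProbTheory.index_eq_zero {M N : Observable K ℝ} (h : compatIndex M N = 0) :
    K.index = 0 := by
  refine le_antisymm ?_ K.index_nonneg
  exact csInf_le ⟨0, fun l ⟨M, N, hl⟩ => hl ▸ compatIndex_nonneg M N⟩ ⟨M, N, h.symm⟩

end General

/-! ### Pure states and their outcome probabilities. -/

section Quantum
variable {H : Type*} [NormedAddCommGroup H] [InnerProductSpace ℂ H] [CompleteSpace H]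

open SATraceClass

omit [CompleteSpace H] in
lemma rankOne_self_nonneg (ψ : H) : 0 ≤ InnerProductSpace.rankOne ℂ ψ ψ := by
  rw [ContinuousLinearMap.nonneg_iff_isPositive]
  exact InnerProductSpace.isPositive_rankOne_self ψ

lemma posTrace_rankOne (ψ : H) : posTrace (InnerProductSpace.rankOne ℂ ψ ψ) = ‖ψ‖ₑ ^ 2 := by
  rw [← parseval (basis H), posTrace]
  congr with i
  rw [InnerProductSpace.rankOne_apply, inner_smul_right, enorm_mul, sq, ← inner_conj_symm ψ,
    enorm_eq_nnnorm, RCLike.nnnorm_conj, enorm_eq_nnnorm]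

/-- The pure state of a unit vector. -/
noncomputable def pureState (ψ : H) (hψ : ‖ψ‖ = 1) : (quantumTheory H).states :=
  ⟨⟨InnerProductSpace.rankOne ℂ ψ ψ, .of_nonneg (rankOne_self_nonneg ψ), by
      rw [posTrace_eq_traceNorm (rankOne_self_nonneg ψ), posTrace_rankOne]
      finiteness⟩,
    rankOne_self_nonneg ψ, by
      change opTrace (InnerProductSpace.rankOne ℂ ψ ψ) = 1
      rw [opTrace_of_nonneg (rankOne_self_nonneg ψ), posTrace_rankOne]
      simp [hψ]⟩

lemma op_pureState (ψ : H) (hψ : ‖ψ‖ = 1) :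
    op (pureState ψ hψ : SATraceClass H) = InnerProductSpace.rankOne ℂ ψ ψ := rfl

/-- This is the expansion of the inner product of `E⋆ψ` and `ψ` in the fixed basis; it turns
probabilities in pure states into quadratic forms. -/
lemma opTrace_rankOne_mul (ψ : H) (E : H →L[ℂ] H) :
    opTrace (InnerProductSpace.rankOne ℂ ψ ψ * E) = ⟪ψ, E ψ⟫_ℂ := by
  rw [← ContinuousLinearMap.adjoint_inner_left, ← (basis H).tsum_inner_mul_inner, opTrace]
  congr with i
  rw [mul_apply_eq_comp, InnerProductSpace.rankOne_apply, inner_smul_right,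
    ContinuousLinearMap.adjoint_inner_left]

lemma POVM.observable_pureState (P : POVM H) (ψ : H) (hψ : ‖ψ‖ = 1) {A : Set ℝ}
    (hA : MeasurableSet A) :
    (P.observable.toFun (pureState ψ hψ) : Measure ℝ).real A = (⟪ψ, P.toFun A ψ⟫_ℂ).re := by
  change (P.dist (pureState ψ hψ) A).toReal = _
  rw [P.dist_apply _ hA, op_pureState, opTrace_rankOne_mul, inner_eq_ofReal (P.nonneg A hA),
    Complex.ofReal_re, ENNReal.toReal_ofReal (norm_nonneg _)]

/-! ### The equator of the Bloch sphere. -/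

variable {e : Fin 2 → H}

/-- The vector `(e₀ + z e₁) / √2`. -/
noncomputable def equator (e : Fin 2 → H) (z : ℂ) : H := ((√2)⁻¹ : ℂ) • (e 0 + z • e 1)

lemma inner_extendOp_equator (he : Orthonormal ℂ e) (A : Matrix (Fin 2) (Fin 2) ℂ) (z : ℂ) :
    ⟪equator e z, extendOp e A (equator e z)⟫_ℂ =
      (A 0 0 + A 0 1 * z + A 1 0 * star z + A 1 1 * (star z * z)) / 2 := by
  have h2 : ((√2 : ℝ) : ℂ) ^ 2 = 2 := by norm_cast; simp
  have h0 : ((√2 : ℝ) : ℂ) ≠ 0 := by norm_cast; simp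
  rw [orthonormal_iff_ite] at he
  simp only [equator, extendOp_apply, Fin.sum_univ_two, inner_add_right, inner_add_left,
    inner_smul_right, inner_smul_left, he, map_inv₀, Complex.conj_ofReal]
  simp
  field_simp
  rw [h2]
  ring

omit [CompleteSpace H] in
lemma inner_equator_self (he : Orthonormal ℂ e) (z : ℂ) (hz : star z * z = 1) :
    ⟪equator e z, equator e z⟫_ℂ = 1 := by
  have h2 : ((√2 : ℝ) : ℂ) ^ 2 = 2 := by norm_cast; simp
  have h0 : ((√2 : ℝ) : ℂ) ≠ 0 := by norm_cast; simp
  rw [orthonormal_iff_ite] at he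
  simp only [equator, inner_add_right, inner_add_left,
    inner_smul_right, inner_smul_left, he, map_inv₀, Complex.conj_ofReal]
  simp at hz ⊢
  field_simp
  rw [h2, mul_comm, hz]
  norm_num

lemma norm_equator (he : Orthonormal ℂ e) (z : ℂ) (hz : star z * z = 1) : ‖equator e z‖ = 1 := by
  rw [norm_eq_sqrt_re_inner (𝕜 := ℂ), inner_equator_self he z hz]
  simp

/-- For |z| = 1 the diagonal is constant and the other two entries are linear in z and its
conjugate, so that mixtures of equatorial states can be compared through complex numbers alone. -/
lemma rankOne_equator (e : Fin 2 → H) (z : ℂ) :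
    InnerProductSpace.rankOne ℂ (equator e z) (equator e z) =
      extendOp e !![1 / 2, star z / 2; z / 2, star z * z / 2] := by
  have h2 : ((√2 : ℝ) : ℂ)⁻¹ * ((√2 : ℝ) : ℂ)⁻¹ = 1 / 2 := by
    rw [← mul_inv]; norm_cast; simp
  ext x
  rw [extendOp_apply, InnerProductSpace.rankOne_apply]
  simp only [equator, Fin.sum_univ_two, inner_add_left, inner_smul_left, map_inv₀,
    Complex.conj_ofReal]
  simp only [Matrix.of_apply, Matrix.cons_val', Matrix.cons_val_zero, Matrix.cons_val_one,
    Matrix.cons_val_fin_one, smul_smul, smul_add, ← add_smul]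
  rw [show ∀ a b : ℂ, ((√2 : ℝ) : ℂ)⁻¹ * (a + b) * ((√2 : ℝ) : ℂ)⁻¹ =
    (((√2 : ℝ) : ℂ)⁻¹ * ((√2 : ℝ) : ℂ)⁻¹) * (a + b) by intros; ring, h2]
  congr 2
  · simp; ring
  · rw [show ∀ a b : ℂ, ((√2 : ℝ) : ℂ)⁻¹ * (a + b) * (((√2 : ℝ) : ℂ)⁻¹ * z) =
      (((√2 : ℝ) : ℂ)⁻¹ * ((√2 : ℝ) : ℂ)⁻¹) * (a + b) * z by intros; ring, h2]
    simp; ring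

/-- The pure state at the point `z` of the equator of the Bloch sphere. -/
noncomputable def equatorState (he : Orthonormal ℂ e) (z : ℂ) (hz : star z * z = 1) :
    (quantumTheory H).states :=
  pureState (equator e z) (norm_equator he z hz)

/-- Convex combinations of equatorial states are determined by those of the Bloch vectors. -/
lemma equatorState_mix_eq (he : Orthonormal ℂ e) {a b c d : ℂ} (ha : star a * a = 1)
    (hb : star b * b = 1) (hc : star c * c = 1) (hd : star d * d = 1) (t u : ℝ)
    (h : t * a + (1 - t) * b = u * c + (1 - u) * d) :
    t • (equatorState he a ha : SATraceClass H) + (1 - t) • (equatorState he b hb : SATraceClass H)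
      = u • (equatorState he c hc : SATraceClass H) +
        (1 - u) • (equatorState he d hd : SATraceClass H) := by
  -- One off-diagonal entry contains the conjugate of z, so the conjugated relation is needed too.
  have h' : t * star a + (1 - t) * star b = u * star c + (1 - u) * star d := by
    simpa using congrArg star h
  refine op_injective ?_
  simp only [map_add, map_smul, equatorState, op_pureState, rankOne_equator, ha, hb, hc, hd]
  ext x
  simp only [add_apply, smul_apply, extendOp_apply, Fin.sum_univ_two]
  simp only [Matrix.of_apply, Matrix.cons_val', Matrix.cons_val_zero, Matrix.cons_val_one,
    Matrix.cons_val_fin_one, ← Complex.coe_smul]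
  push_cast
  linear_combination (norm := module) ((1 / 2 * ⟪e 0, x⟫_ℂ) • h) • e 1 +
    ((1 / 2 * ⟪e 1, x⟫_ℂ) • h') • e 0

lemma spinPOVM_singleton_one (he : Orthonormal ℂ e) {A : Matrix (Fin 2) (Fin 2) ℂ}
    (hA : A.IsHermitian) (hA2 : A * A = 1) :
    (spinPOVM e he A hA hA2).toFun {1} = (1 / 2 : ℂ) • (1 + extendOp e A) := by
  simp [spinPOVM, show (-1 : ℝ) ≠ 1 by norm_num]

lemma spinPOVM_real_one (he : Orthonormal ℂ e) {A : Matrix (Fin 2) (Fin 2) ℂ}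
    (hA : A.IsHermitian) (hA2 : A * A = 1) (z : ℂ) (hz : star z * z = 1) :
    ((spinPOVM e he A hA hA2).observable.toFun (equatorState he z hz) : Measure ℝ).real {1} =
      (1 + ((A 0 0 + A 0 1 * z + A 1 0 * star z + A 1 1) / 2).re) / 2 := by
  rw [equatorState, POVM.observable_pureState _ _ _ (measurableSet_singleton _),
    spinPOVM_singleton_one, smul_apply, inner_smul_right, add_apply, inner_add_right,
    inner_extendOp_equator he, one_apply_eq_self, inner_equator_self he z hz, hz, mul_one,
    show (1 / 2 : ℂ) = ((1 / 2 : ℝ) : ℂ) by push_cast; rfl, Complex.re_ofReal_mul, Complex.add_re,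
    Complex.one_re]
  ring

lemma obsX_real_one (he : Orthonormal ℂ e) (z : ℂ) (hz : star z * z = 1) :
    ((obsX e he).toFun (equatorState he z hz) : Measure ℝ).real {1} = (1 + z.re) / 2 := by
  rw [obsX, spinPOVM_real_one]
  simp [pauliX]

lemma obsY_real_one (he : Orthonormal ℂ e) (z : ℂ) (hz : star z * z = 1) :
    ((obsY e he).toFun (equatorState he z hz) : Measure ℝ).real {1} = (1 + z.im) / 2 := by
  rw [obsY, spinPOVM_real_one]
  simp [pauliY]

/-! ### The tangency estimate and the incompatibility of the spin observables. -/

/-- An outcome of an observable that is impossible in the equatorial state `-w` has a small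
probability in the equatorial states near `-w`. -/
lemma real_equatorState_le (he : Orthonormal ℂ e) {X : Type*} [MeasurableSpace X]
    (J : Observable (quantumTheory H) X) {B : Set X} (hB : MeasurableSet B) {w a b : ℂ}
    (hw : star w * w = 1) (hw' : star (-w) * -w = 1) (ha : star a * a = 1) (hb : star b * b = 1)
    {c : ℝ} (hc : c ∈ Set.Icc (0 : ℝ) 1) (hab : a + b = -(2 * c * w))
    (h0 : (J.toFun (equatorState he (-w) hw') : Measure X).real B = 0) :
    (J.toFun (equatorState he a ha) : Measure X).real B ≤ 1 - c := by
  -- The midpoint of `a` and `b` is `-c w`, which lies on the diameter through `w` and `-w` and has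
  -- weight (1 - c)/2 at `w`. As `-w` contributes nothing, the probabilities at `a` and `b` add up
  -- to 1 - c times that at `w`.
  have h := J.real_mix_eq hB (equatorState he a ha) (equatorState he b hb)
    (equatorState he w hw) (equatorState he (-w) hw') ⟨1 / 2, by norm_num, by norm_num⟩
    ⟨(1 - c) / 2, by linarith [hc.2], by linarith [hc.1]⟩
    (equatorState_mix_eq he ha hb hw hw' _ _ (by push_cast; linear_combination hab / 2))
  simp only [h0] at h
  have h1 : (J.toFun (equatorState he w hw) : Measure X).real B ≤ 1 := measureReal_le_one
  have h2 : 0 ≤ (J.toFun (equatorState he b hb) : Measure X).real B := measureReal_nonneg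
  nlinarith [hc.2]

lemma eq_zero_of_compatible_mix (he : Orthonormal ℂ e) {μ : unitInterval}
    {T : Observable (quantumTheory H) ℝ} (hT : T ∈ trivialObservables (quantumTheory H))
    (h : Compatible ![obsX e he, Observable.mix μ (obsY e he) T]) : μ = 0 := by
  obtain ⟨p, rfl⟩ := hT
  obtain ⟨J, hJ⟩ := h
  have hm1 : MeasurableSet ({1} : Set ℝ) := measurableSet_singleton 1
  have hm : ∀ (i : Fin 2) {A : Set ℝ}, MeasurableSet A →
      MeasurableSet {x : Fin 2 → ℝ | x i ∈ A} := fun i _ hA => measurable_pi_apply i hA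
  have hX : ∀ s {A : Set ℝ}, MeasurableSet A → (J.toFun s : Measure (Fin 2 → ℝ)).real
      {x | x 0 ∈ A} = ((obsX e he).toFun s : Measure ℝ).real A := fun s A hA =>
    congrArg ENNReal.toReal (hJ 0 s A hA)
  have hY : ∀ s, (J.toFun s : Measure (Fin 2 → ℝ)).real {x | x 1 ∈ ({1} : Set ℝ)} =
      μ * ((obsY e he).toFun s : Measure ℝ).real {1} + (1 - μ) * (p : Measure ℝ).real {1} := by
    intro s
    refine (congrArg ENNReal.toReal (hJ 1 s {1} hm1)).trans ?_
    simp only [Matrix.cons_val_one, Matrix.cons_val_fin_one, Observable.mix, trivialObservable,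
      ProbabilityMeasure.coe_mk, Measure.add_apply, Measure.smul_apply, ENNReal.smul_def,
      smul_eq_mul]
    rw [ENNReal.toReal_add (by finiteness) (by finiteness)]
    simp [measureReal_def]
  -- These are the events behind p₊ and p₋. The complement of {1}, rather than {-1}, makes them
  -- partition the event that the second outcome is 1, without recourse to the support of M_x.
  set Bp : Set (Fin 2 → ℝ) := {x | x 0 ∈ ({1} : Set ℝ)} ∩ {x | x 1 ∈ ({1} : Set ℝ)}
  set Bm : Set (Fin 2 → ℝ) := {x | x 0 ∈ ({1} : Set ℝ)ᶜ} ∩ {x | x 1 ∈ ({1} : Set ℝ)}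
  have hBp : MeasurableSet Bp := (hm 0 hm1).inter (hm 1 hm1)
  have hBm : MeasurableSet Bm := (hm 0 hm1.compl).inter (hm 1 hm1)
  have hsum : ∀ s, (J.toFun s : Measure (Fin 2 → ℝ)).real Bp +
      (J.toFun s : Measure (Fin 2 → ℝ)).real Bm =
      μ * ((obsY e he).toFun s : Measure ℝ).real {1} + (1 - μ) * (p : Measure ℝ).real {1} := by
    intro s
    rw [← hY, ← measureReal_union _ hBm, ← Set.union_inter_distrib_right]
    · congr 1
      ext x
      simp [em]
    · refine Set.disjoint_left.2 fun x hx hx' => hx'.1 hx.1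
  have hp1 : star (1 : ℂ) * 1 = 1 := by simp
  have hn1 : star (-1 : ℂ) * -1 = 1 := by simp
  -- The point 1 is written as `-(-1)` to match the zero `-w` of `real_equatorState_le` for `w =
  -- -1`.
  have hnn1 : star (-(-1) : ℂ) * -(-1) = 1 := by simp
  have hp0 : (J.toFun (equatorState he (-1) hn1) : Measure (Fin 2 → ℝ)).real Bp = 0 := by
    refine le_antisymm ((measureReal_mono Set.inter_subset_left).trans ?_) measureReal_nonneg
    rw [hX _ hm1, obsX_real_one]
    simp
  have hm0 : (J.toFun (equatorState he (-(-1)) hnn1) : Measure (Fin 2 → ℝ)).real Bm = 0 := by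
    refine le_antisymm ((measureReal_mono Set.inter_subset_left).trans ?_) measureReal_nonneg
    rw [hX _ hm1.compl, probReal_compl_eq_one_sub hm1, obsX_real_one]
    simp
  -- Passing from Im z = -s to Im z = s at fixed Re z changes p₊ + p₋ by μ s, while each of p₊ and
  -- p₋ can account for at most 1 - c = t s.
  have key : ∀ t : ℝ, 0 < t → t ≤ 1 → (μ : ℝ) ≤ 2 * t := by
    intro t ht ht1
    have hpos : 0 < 1 + t ^ 2 := by positivity
    -- Here c and s are the cosine and sine of the angle θ with t = tan(θ/2), so that 1 - c is
    -- smaller than s by the factor t.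
    obtain ⟨c, hcdef⟩ : ∃ c, c = (1 - t ^ 2) / (1 + t ^ 2) := ⟨_, rfl⟩
    obtain ⟨s, hsdef⟩ : ∃ s, s = 2 * t / (1 + t ^ 2) := ⟨_, rfl⟩
    have hcs : c ^ 2 + s ^ 2 = 1 := by rw [hcdef, hsdef]; field_simp; ring
    have hc1 : 1 - c = t * s := by rw [hcdef, hsdef]; field_simp; ring
    have hs0 : 0 < s := by rw [hsdef]; positivity
    have hc : c ∈ Set.Icc (0 : ℝ) 1 :=
      ⟨by rw [hcdef]; exact div_nonneg (by nlinarith) hpos.le, by nlinarith⟩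
    have hunit : ∀ x y : ℝ, x ^ 2 + y ^ 2 = 1 → star (⟨x, y⟩ : ℂ) * ⟨x, y⟩ = 1 := by
      intro x y hxy
      apply Complex.ext <;> simp <;> linarith
    have h1 : star (⟨-c, s⟩ : ℂ) * ⟨-c, s⟩ = 1 := hunit _ _ (by linarith)
    have h2 : star (⟨-c, -s⟩ : ℂ) * ⟨-c, -s⟩ = 1 := hunit _ _ (by linarith)
    have h3 : star (⟨c, s⟩ : ℂ) * ⟨c, s⟩ = 1 := hunit _ _ hcs
    have h4 : star (⟨c, -s⟩ : ℂ) * ⟨c, -s⟩ = 1 := hunit _ _ (by linarith)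
    have hBp1 := real_equatorState_le he J hBp hp1 hn1 h1 h2 hc
      (by apply Complex.ext <;> simp; ring) hp0
    have hBm1 := real_equatorState_le he J hBm hn1 hnn1 h3 h4 hc
      (by apply Complex.ext <;> simp; ring) hm0
    -- The two diagonals of the rectangle with corners (±c, ±s) share their midpoint. Hence p₋ has
    -- the same vertical increment at Re z = -c, where the sum is evaluated, as at Re z = c, where
    -- p₋ is known to be small.
    have hpar := J.real_mix_eq hBm (equatorState he _ h1) (equatorState he _ h4)
      (equatorState he _ h2) (equatorState he _ h3) ⟨1 / 2, by norm_num, by norm_num⟩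
      ⟨1 / 2, by norm_num, by norm_num⟩ (equatorState_mix_eq he h1 h4 h2 h3 _ _
        (by apply Complex.ext <;> simp <;> ring))
    have e1 := hsum (equatorState he _ h1)
    have e2 := hsum (equatorState he _ h2)
    rw [obsY_real_one] at e1 e2
    dsimp only at e1 e2 hpar
    have n1 : 0 ≤ (J.toFun (equatorState he _ h2) : Measure (Fin 2 → ℝ)).real Bp :=
      measureReal_nonneg
    have n2 : 0 ≤ (J.toFun (equatorState he _ h4) : Measure (Fin 2 → ℝ)).real Bm :=
      measureReal_nonneg
    -- Subtracting `e2` from `e1` removes p{1}. By `hpar` the rest is at most p₊ at (-c, s) plus p₋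
    -- at (c, s), hence at most 2(1 - c).
    have : (μ : ℝ) * s ≤ 2 * t * s := by linarith
    exact le_of_mul_le_mul_right this hs0
  have hμ : (μ : ℝ) ≤ 0 := by
    by_contra! hpos
    -- This choice of t yields μ ≤ μ/2.
    have := key (μ / 4) (by linarith) (by linarith [μ.2.2])
    linarith
  exact Subtype.ext (le_antisymm hμ μ.2.1)

lemma compatInterval_obsX_obsY (he : Orthonormal ℂ e) :
    compatInterval (obsX e he) (obsY e he) = {0} := by
  refine subset_antisymm ?_ (Set.singleton_subset_iff.2 (zero_mem_compatInterval _ _))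
  rintro l ⟨hl, T, hT, h⟩
  exact congrArg Subtype.val (eq_zero_of_compatible_mix he hT h)

lemma compatIndex_obsX_obsY (he : Orthonormal ℂ e) :
    compatIndex (obsX e he) (obsY e he) = 0 := by
  rw [compatIndex, compatInterval_obsX_obsY, csSup_singleton]

omit [CompleteSpace H] in
lemma exists_orthonormal_pair (hH : 2 ≤ Module.rank ℂ H) : ∃ e : Fin 2 → H, Orthonormal ℂ e := by
  obtain ⟨v, hv⟩ := (le_rank_iff_exists_linearIndependent_finset (n := 2)).1 (by exact_mod_cast hH)
  obtain ⟨hcard, hv⟩ := hv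
  exact ⟨_, InnerProductSpace.gramSchmidtNormed_orthonormal
    (hv.comp _ (v.equivFinOfCardEq hcard).symm.injective)⟩

end Quantum
end GPT


theorem mainTheorem4 {H : Type*} [NormedAddCommGroup H] [InnerProductSpace ℂ H] [CompleteSpace H]
    (hH : 2 ≤ Module.rank ℂ H) :
    (∀ (e : Fin 2 → H) (he : Orthonormal ℂ e),
      (∀ (μ : unitInterval) (T : GPT.Observable (GPT.quantumTheory H) ℝ),
        T ∈ GPT.trivialObservables (GPT.quantumTheory H) →
        (GPT.Compatible ![GPT.obsX e he, GPT.Observable.mix μ (GPT.obsY e he) T] ↔ μ = 0)) ∧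
      GPT.compatInterval (GPT.obsX e he) (GPT.obsY e he) = {0} ∧
      GPT.compatIndex (GPT.obsX e he) (GPT.obsY e he) = 0) ∧
    (GPT.quantumTheory H).interval = {0} ∧
    (GPT.quantumTheory H).index = 0 ∧
    (∀ (V : Type*) [NormedAddCommGroup V] [NormedSpace ℝ V] [CompleteSpace V]
      (K : GPT.ProbTheory V), (GPT.quantumTheory H).index ≤ K.index) := by
  obtain ⟨e, he⟩ := GPT.exists_orthonormal_pair hH
  refine ⟨fun e he => ⟨fun μ T hT => ⟨GPT.eq_zero_of_compatible_mix he hT, ?_⟩,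
    GPT.compatInterval_obsX_obsY he, GPT.compatIndex_obsX_obsY he⟩,
    GPT.ProbTheory.interval_eq_zero (GPT.compatInterval_obsX_obsY he),
    GPT.ProbTheory.index_eq_zero (GPT.compatIndex_obsX_obsY he), ?_⟩
  · rintro rfl
    exact GPT.compatible_mix_zero _ _ hT
  · intro V _ _ _ K
    rw [GPT.ProbTheory.index_eq_zero (GPT.compatIndex_obsX_obsY he)]
    exact K.index_nonneg
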